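/- **Theorem 3.2.** *Setting.* For each integer $d\ge 1$ let $F_d,G_d$ be separable real Hilbert spaces and $S_d:F_d\to G_d$ a nonzero compact linear operator; write $\mathcal S=\{S_d\}_{d\ge1}$. A cost function is a map $\$:[0,\infty)\times\{1,2,\dots\}\to[1,\infty]$, $(\sigma,d)\mapsto\$(\sigma,d)$, that is non-increasing in $\sigma$ and non-decreasing in $d$. (Adaptive) information $N$ on $F_d$ consists of a set $Y$ of finite real sequences such that every infinite real sequence has exactly one initial segment in $Y$, and, for every finite sequence $(y_1,\dots,y_{i-1})$, of a continuous linear functional $L_i(\cdot\,;y_1,\dots,y_{i-1})$ on $F_d$ of norm at most one and a precision $\sigma_i(y_1,\dots,y_{i-1})\ge0$. For $f\in F_d$ let $N(f)$ be the set of all $\mathbf y=(y_1,\dots,y_{n(\mathbf y)})\in Y$ with $|y_i-L_i(f;y_1,\dots,y_{i-1})|\le\sigma_i(y_1,\dots,y_{i-1})$ for $1\le i\le n(\mathbf y)$. An algorithm is an arbitrary map $\Phi:Y\to G_d$. Put $$\mathrm{cost}_\$(N)=\sup_{\|f\|\le1}\ \sup_{\mathbf y\in N(f)}\ \sum_{i=1}^{n(\mathbf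 y)}\$(\sigma_i(y_1,\dots,y_{i-1}),d),\qquad \mathrm e(S_d,N,\Phi)=\sup_{\|f\|\le1}\ \sup_{\mathbf y\in N(f)}\|S_d(f)-\Phi(\mathbf y)\|,$$ $$\mathrm{comp}_\$(\varepsilon,d)=\inf\{\mathrm{cost}_\$(N):\ N,\Phi\text{ with }\mathrm e(S_d,N,\Phi)\le\varepsilon\|S_d\|\},$$ and let $\mathrm n^{\mathrm w}(\varepsilon,d)$ be $\mathrm{comp}_\$(\varepsilon,d)$ for the constant cost function $\$\equiv1$ (exact information). A problem with complexity $\mathrm{comp}$ (that is, $\mathrm{comp}_\$$ for noisy and $\mathrm n^{\mathrm w}$ for exact information) is polynomially tractable if there are $C,q,p\ge0$ with $\mathrm{comp}(\varepsilon,d)\le Cd^q\varepsilon^{-p}$ for all $d\ge1$, $\varepsilon\in(0,1)$, and strongly polynomially tractable if this holds with $q=0$. Write $\psi_1\preccurlyeq\psi_2$ if there is $A<\infty$ with $\psi_1(\varepsilon,d)\le A\,\psi_2(\varepsilon,d)$ for all $\varepsilon\in(0,1)$, $d\ge1$. *Claim.* For every such $\mathcal S$ and $\$$: (i) The problem with noisy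 information is polynomially tractable if and only if it is polynomially tractable for exact information and there are $D,t,s\ge0$ with $\$(\sigma,d)\le1+Dd^t\sigma^{-s}$ for all $d\ge1$, $\sigma\in(0,1)$. (ii) The problem with noisy information is strongly polynomially tractable if and only if it is strongly polynomially tractable for exact information, there are $D,s\ge0$ with $\$(\sigma,d)\le1+D\sigma^{-s}$ for all $d\ge1$, $\sigma\in(0,1)$, and $\sup_{d\ge1}\$(\sigma,d)<\infty$ for every $\sigma>0$. (iii) Let $C,q,p,D,t,s\ge0$ be such that $\mathrm n^{\mathrm w}(\varepsilon,d)\le Cd^q\varepsilon^{-p}$ and $\$(\sigma,d)\le1+Dd^t\sigma^{-2s}$ for all $d\ge1$, $\varepsilon,\sigma\in(0,1)$. If $p=0$ and $s=0$, then $\mathrm{comp}_\$(\varepsilon,d)\preccurlyeq d^{t+q}$; otherwise $$\mathrm{comp}_\$(\varepsilon,d)\preccurlyeq d^{t+q(s+1)}\begin{cases}\varepsilon^{-p(s+1)},&p(s+1)>2s,\\(1+\ln(1/\varepsilon))^{s+1}\,\varepsilon^{-2s},&p(s+1)=2s,\\\varepsilon^{-2s},&p(s+1)<2s.\end{cases}$$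 -/

import Mathlib

open scoped NNReal ENNReal

namespace NoisyInfo

/-- A cost function: `cost σ d ∈ [1, ∞]` is the price of one evaluation of a functional with
precision `σ ≥ 0` in dimension `d ≥ 1`; it is non-decreasing in `σ⁻¹` (where `0⁻¹ = ∞`) and in `d`. -/
structure CostFunction where
  toFun : ℝ≥0 → ℕ+ → ℝ≥0∞
  one_le : ∀ σ d, 1 ≤ toFun σ d
  antitone_precision : ∀ d, Antitone fun σ => toFun σ d
  monotone_dim : ∀ σ, Monotone (toFun σ)

instance : CoeFun CostFunction fun _ => ℝ≥0 → ℕ+ → ℝ≥0∞ := ⟨CostFunction.toFun⟩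

/-- The cost function that is constantly `1`: information is available exactly (precision `0`) at
unit cost, so that the cost of information is the number of evaluations. -/
def CostFunction.unit : CostFunction where
  toFun _ _ := 1
  one_le _ _ := le_rfl
  antitone_precision _ _ _ _ := le_rfl
  monotone_dim _ _ _ _ := le_rfl

/-- Adaptive information on `F`. After the values `y = [y₁, …, yᵢ₋₁]` have been observed, the next
functional is `functional y`, an arbitrary element of the unit ball of the dual, and it is
observed with precision `precision y`. The process stops as soon as the list of observed values
belongs to `Y`; every infinite sequence of values has exactly one initial segment in `Y`. -/
structure Information (F : Type*) [NormedAddCommGroup F] [InnerProductSpace ℝ F] where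
  functional : List ℝ → (F →L[ℝ] ℝ)
  norm_functional_le : ∀ y, ‖functional y‖ ≤ 1
  precision : List ℝ → ℝ≥0
  Y : Set (List ℝ)
  terminates : ∀ y : ℕ → ℝ, ∃! n : ℕ, (List.range n).map y ∈ Y

section Setting

variable {F G : Type*} [NormedAddCommGroup F] [InnerProductSpace ℝ F]
  [NormedAddCommGroup G] [InnerProductSpace ℝ G]

/-- The set `N(f)` of all possible values of information about `f` under bounded noise:
`|yᵢ - Lᵢ(f; y₁, …, yᵢ₋₁)| ≤ σᵢ(y₁, …, yᵢ₋₁)` for all `i`. -/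
def Information.values (N : Information F) (f : F) : Set (List ℝ) :=
  {y | y ∈ N.Y ∧ ∀ i (hi : i < y.length),
    |y[i] - N.functional (y.take i) f| ≤ (N.precision (y.take i) : ℝ)}

/-- The worst case cost of information in dimension `d`: the supremum over `‖f‖ ≤ 1` and
`y ∈ N(f)` of the sum of the prices of the individual evaluations. -/
noncomputable def Information.totalCost (N : Information F) (cost : CostFunction) (d : ℕ+) : ℝ≥0∞ :=
  ⨆ (f : F) (_ : ‖f‖ ≤ 1) (y : List ℝ) (_ : y ∈ N.values f),
    ∑ i ∈ Finset.range y.length, cost (N.precision (y.take i)) d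

/-- The worst case error of the algorithm `Φ` using information `N`. (Only the values of `Φ`
on `N.Y` matter.) -/
noncomputable def worstError (S : F →L[ℝ] G) (N : Information F) (Φ : List ℝ → G) : ℝ≥0∞ :=
  ⨆ (f : F) (_ : ‖f‖ ≤ 1) (y : List ℝ) (_ : y ∈ N.values f), ENNReal.ofReal ‖S f - Φ y‖

end Setting

section Tractability

variable {F G : ℕ+ → Type*} [∀ d, NormedAddCommGroup (F d)] [∀ d, InnerProductSpace ℝ (F d)]
  [∀ d, NormedAddCommGroup (G d)] [∀ d, InnerProductSpace ℝ (G d)]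

/-- The information `(ε, d)`-complexity: the minimal (infimal) cost of information that allows
an algorithm with error at most `ε ‖S_d‖`. -/
noncomputable def complexity (S : ∀ d, F d →L[ℝ] G d) (cost : CostFunction) (ε : ℝ) (d : ℕ+) :
    ℝ≥0∞ :=
  ⨅ (N : Information (F d)) (Φ : List ℝ → G d)
    (_ : worstError (S d) N Φ ≤ ENNReal.ofReal (ε * ‖S d‖)), N.totalCost cost d

/-- The complexity `n^w(ε, d)` for exact information: every evaluation costs `1`. -/
noncomputable def exactComplexity (S : ∀ d, F d →L[ℝ] G d) (ε : ℝ) (d : ℕ+) : ℝ≥0∞ :=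
  complexity S CostFunction.unit ε d

/-- Polynomial tractability of a problem whose `(ε, d)`-complexity is `comp ε d`. -/
def PolynomiallyTractable (comp : ℝ → ℕ+ → ℝ≥0∞) : Prop :=
  ∃ C q p : ℝ, 0 ≤ C ∧ 0 ≤ q ∧ 0 ≤ p ∧ ∀ d : ℕ+, ∀ ε : ℝ, 0 < ε → ε < 1 →
    comp ε d ≤ ENNReal.ofReal (C * (d : ℝ) ^ q * ε ^ (-p))

/-- Strong polynomial tractability of a problem whose `(ε, d)`-complexity is `comp ε d`:
the bound does not depend on `d`. -/
def StronglyPolynomiallyTractable (comp : ℝ → ℕ+ → ℝ≥0∞) : Prop :=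
  ∃ C p : ℝ, 0 ≤ C ∧ 0 ≤ p ∧ ∀ d : ℕ+, ∀ ε : ℝ, 0 < ε → ε < 1 →
    comp ε d ≤ ENNReal.ofReal (C * ε ^ (-p))

/-- `comp ε d ≼ ψ ε d`: there is a finite constant `A` with `comp ε d ≤ A * ψ ε d` for all
`ε ∈ (0, 1)` and `d ≥ 1`. -/
def Dominated (comp : ℝ → ℕ+ → ℝ≥0∞) (ψ : ℝ → ℕ+ → ℝ) : Prop :=
  ∃ A : ℝ, 0 ≤ A ∧ ∀ d : ℕ+, ∀ ε : ℝ, 0 < ε → ε < 1 → comp ε d ≤ ENNReal.ofReal (A * ψ ε d)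

end Tractability

/-- Polynomial growth of the cost function in `σ⁻¹` and `d`. -/
def CostFunction.PolynomialGrowth (cost : CostFunction) : Prop :=
  ∃ D t s : ℝ, 0 ≤ D ∧ 0 ≤ t ∧ 0 ≤ s ∧ ∀ d : ℕ+, ∀ σ : ℝ≥0, 0 < σ → σ < 1 →
    cost σ d ≤ 1 + ENNReal.ofReal (D * (d : ℝ) ^ t * (σ : ℝ) ^ (-s))

/-- Polynomial growth of the cost function in `σ⁻¹`, with constants that do not depend on `d`. -/
def CostFunction.PolynomialGrowthUniformInDim (cost : CostFunction) : Prop :=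
  ∃ D s : ℝ, 0 ≤ D ∧ 0 ≤ s ∧ ∀ d : ℕ+, ∀ σ : ℝ≥0, 0 < σ → σ < 1 →
    cost σ d ≤ 1 + ENNReal.ofReal (D * (σ : ℝ) ^ (-s))

/-- For every `σ > 0` the cost `cost σ d` is bounded in `d`. -/
def CostFunction.BoundedInDim (cost : CostFunction) : Prop :=
  ∀ σ : ℝ≥0, 0 < σ → ∃ B : ℝ, ∀ d : ℕ+, cost σ d ≤ ENNReal.ofReal B

end NoisyInfo

open NoisyInfo

/-! Necessity comes from the path on which every observation is `0`. If all precisions along it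
exceeded ε, a ball of radius δ > ε would produce the same data, forcing δ‖S‖ ≤ ε‖S‖; hence some
observation has precision at most ε (`cost_le_totalCost`). Since every price is at least one, noisy
complexity also dominates exact complexity.

For the upper bound, the zero path turns exact information into a subspace V with dim V bounded by
the exact complexity and S small on Vᗮ. Diagonalizing S on V for accuracy ε/2 gives an orthonormal
basis with orthogonal images, and the subspaces for the other accuracies η bound how many normalized
image norms exceed η (`card_filter_lt_norm_le_finrank`). Observing these coordinates splits the
error into truncation, at most ε/2, and noise, whose square is bounded by Σ σᵢ²‖S bᵢ‖². The
precisions are chosen by a Lagrange multiplier (`exists_precision`), so the price reduces to a sum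
of powers of truncated image norms. A dyadic decomposition compares that sum with a geometric one
(`PolynomialDecay.sum_rpow_le`); ratio above, equal to, or below one gives the three rates. -/

namespace NoisyInfo

/-! ### Lower bounds from the zero path -/

section LowerBounds

variable {F G : Type*} [NormedAddCommGroup F] [InnerProductSpace ℝ F]
  [NormedAddCommGroup G] [InnerProductSpace ℝ G]

/-- Constantly observing `0` is a terminating sequence of observations. -/
theorem Information.exists_replicate_mem (N : Information F) :
    ∃ n : ℕ, List.replicate n (0 : ℝ) ∈ N.Y := by
  obtain ⟨n, hn, -⟩ := N.terminates fun _ => 0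
  exact ⟨n, by simpa using hn⟩

theorem Information.mem_values_replicate (N : Information F) {n : ℕ}
    (hn : List.replicate n (0 : ℝ) ∈ N.Y) (f : F)
    (h : ∀ i < n, |N.functional (List.replicate i 0) f| ≤ N.precision (List.replicate i 0)) :
    List.replicate n (0 : ℝ) ∈ N.values f := by
  refine ⟨hn, fun i hi => ?_⟩
  have hi' : i < n := by simpa using hi
  have := h i hi'
  simpa [List.take_replicate, min_eq_left hi'.le] using this

theorem Information.sum_cost_replicate_le (N : Information F) (cost : CostFunction) (d : ℕ+)
    {n : ℕ} (hn : List.replicate n (0 : ℝ) ∈ N.Y) :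
    ∑ i ∈ Finset.range n, cost (N.precision (List.replicate i 0)) d ≤ N.totalCost cost d := by
  have h0 : List.replicate n (0 : ℝ) ∈ N.values 0 :=
    N.mem_values_replicate hn 0 fun i _ => by simp
  have h1 := le_iSup₂_of_le (f := fun (f : F) (_ : ‖f‖ ≤ 1) => ⨆ (y : List ℝ) (_ : y ∈ N.values f),
    ∑ i ∈ Finset.range y.length, cost (N.precision (y.take i)) d) 0 (by simp)
    (le_iSup₂_of_le (f := fun (y : List ℝ) (_ : y ∈ N.values 0) =>
      ∑ i ∈ Finset.range y.length, cost (N.precision (y.take i)) d) _ h0 le_rfl)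
  refine le_trans (le_of_eq ?_) h1
  simp only [List.length_replicate]
  refine Finset.sum_congr rfl fun i hi => ?_
  rw [List.take_replicate, min_eq_left (Finset.mem_range.1 hi).le]

theorem norm_sub_le_of_worstError_le {S : F →L[ℝ] G} {N : Information F} {Φ : List ℝ → G}
    {c : ℝ} (hc : 0 ≤ c) (h : worstError S N Φ ≤ ENNReal.ofReal c) {f : F} (hf : ‖f‖ ≤ 1)
    {y : List ℝ} (hy : y ∈ N.values f) : ‖S f - Φ y‖ ≤ c := by
  simp only [worstError, iSup_le_iff] at h
  exact (ENNReal.ofReal_le_ofReal_iff hc).1 (h f hf y hy)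

/-- If `f` and `-f` cannot be distinguished, the error is at least `‖S f‖`. -/
theorem norm_le_of_worstError_le {S : F →L[ℝ] G} {N : Information F} {Φ : List ℝ → G}
    {c : ℝ} (hc : 0 ≤ c) (h : worstError S N Φ ≤ ENNReal.ofReal c) {f : F} (hf : ‖f‖ ≤ 1)
    {y : List ℝ} (hy : y ∈ N.values f) (hy' : y ∈ N.values (-f)) : ‖S f‖ ≤ c := by
  have h1 := norm_sub_le_of_worstError_le hc h hf hy
  have h2 := norm_sub_le_of_worstError_le hc h (by simpa using hf) hy'
  have h3 : (2 : ℝ) * ‖S f‖ = ‖(S f - Φ y) - (S (-f) - Φ y)‖ := by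
    rw [map_neg, show S f - Φ y - (-S f - Φ y) = (2 : ℝ) • S f by rw [two_smul]; abel, norm_smul]
    simp
  linarith [norm_sub_le (S f - Φ y) (S (-f) - Φ y)]

theorem Information.totalCost_unit_le (N : Information F) (cost : CostFunction) (d : ℕ+) :
    N.totalCost CostFunction.unit d ≤ N.totalCost cost d :=
  iSup₂_mono fun _ _ => iSup₂_mono fun _ _ => Finset.sum_le_sum fun _ _ => cost.one_le _ _

/-- Information with small error has an observation of high precision on the zero path. -/
theorem cost_le_totalCost {S : F →L[ℝ] G} (hS : S ≠ 0) {N : Information F} {Φ : List ℝ → G}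
    (cost : CostFunction) (d : ℕ+) {ε : ℝ≥0} (hε : ε < 1)
    (h : worstError S N Φ ≤ ENNReal.ofReal (ε * ‖S‖)) :
    cost ε d ≤ N.totalCost cost d := by
  obtain ⟨n, hn⟩ := N.exists_replicate_mem
  have hS' : 0 < ‖S‖ := norm_pos_iff.2 hS
  obtain ⟨i, hi, hle⟩ : ∃ i < n, N.precision (List.replicate i 0) ≤ ε := by
    by_contra! hlt
    -- δ is the minimum of `1` and the finitely many precisions; the cap `1` keeps the δ-ball inside
    -- the unit ball and covers `n = 0`.
    obtain ⟨δ, hεδ, hδ1, hδ⟩ : ∃ δ : ℝ≥0, ε < δ ∧ δ ≤ 1 ∧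
        ∀ i < n, δ ≤ N.precision (List.replicate i 0) := by
      clear hn
      induction n with
      | zero => exact ⟨1, hε, le_rfl, by simp⟩
      | succ n ih =>
        obtain ⟨δ, h1, h2, h3⟩ := ih fun i hi => hlt i (by omega)
        refine ⟨min δ (N.precision (List.replicate n 0)), lt_min h1 (hlt n (by omega)),
          (min_le_left _ _).trans h2, fun i hi => ?_⟩
        rcases Nat.lt_succ_iff_lt_or_eq.1 hi with hi | rfl
        · exact (min_le_left _ _).trans (h3 i hi)
        · exact min_le_right _ _
    have hmem : ∀ f : F, ‖f‖ ≤ δ → List.replicate n (0 : ℝ) ∈ N.values f := fun f hf =>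
      N.mem_values_replicate hn f fun i hi => by
        have := (N.functional (List.replicate i 0)).le_of_opNorm_le (N.norm_functional_le _) f
        rw [one_mul, Real.norm_eq_abs] at this
        exact this.trans (hf.trans (NNReal.coe_le_coe.2 (hδ i hi)))
    have hδ0 : (0 : ℝ) < δ := lt_of_le_of_lt ε.2 (NNReal.coe_lt_coe.2 hεδ)
    have hbound : ‖S‖ ≤ ε * ‖S‖ / δ := by
      refine S.opNorm_le_bound (by positivity) fun x => ?_
      rcases eq_or_ne x 0 with rfl | hx
      · simp
      have hx' : 0 < ‖x‖ := norm_pos_iff.2 hx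
      have hfn : ‖((δ : ℝ) / ‖x‖) • x‖ = δ := by
        rw [norm_smul, Real.norm_of_nonneg (by positivity)]; field_simp
      have := norm_le_of_worstError_le (by positivity) h
        (hfn.le.trans (by exact_mod_cast hδ1)) (hmem _ hfn.le) (hmem _ (by rw [norm_neg, hfn]))
      rw [map_smul, norm_smul, Real.norm_of_nonneg (by positivity), div_mul_eq_mul_div,
        div_le_iff₀ hx'] at this
      rw [div_mul_eq_mul_div, le_div_iff₀ hδ0]
      linarith
    rw [le_div_iff₀ hδ0] at hbound
    have : (ε : ℝ) < δ := NNReal.coe_lt_coe.2 hεδ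
    nlinarith
  calc cost ε d ≤ cost (N.precision (List.replicate i 0)) d := cost.antitone_precision d hle
    _ ≤ _ := Finset.single_le_sum (f := fun i => cost (N.precision (List.replicate i 0)) d)
      (fun _ _ => zero_le) (Finset.mem_range.2 hi)
    _ ≤ _ := N.sum_cost_replicate_le cost d hn

/-- Information of finite cardinality with small error yields a small subspace on whose
orthogonal complement the operator is small. -/
theorem exists_submodule_of_totalCost_lt [CompleteSpace F] {S : F →L[ℝ] G} {N : Information F}
    {Φ : List ℝ → G} {c : ℝ} (hc : 0 ≤ c) (h : worstError S N Φ ≤ ENNReal.ofReal c) (d : ℕ+)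
    {k : ℕ} (hk : N.totalCost CostFunction.unit d < k + 1) :
    ∃ V : Submodule ℝ F, FiniteDimensional ℝ V ∧ Module.finrank ℝ V ≤ k ∧
      ∀ f ∈ Vᗮ, ‖S f‖ ≤ c * ‖f‖ := by
  obtain ⟨n, hn⟩ := N.exists_replicate_mem
  have hnk : n ≤ k := by
    have := (N.sum_cost_replicate_le CostFunction.unit d hn).trans_lt hk
    simp only [CostFunction.unit, Finset.sum_const, Finset.card_range, nsmul_eq_mul,
      mul_one] at this
    exact Nat.lt_succ_iff.1 (by exact_mod_cast this)
  -- Riesz representers of the functionals on the zero path. Adaption plays no role: a vector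
  -- orthogonal to all of them, with any scaling, stays on this path.
  let v : Fin n → F := fun i =>
    (InnerProductSpace.toDual ℝ F).symm (N.functional (List.replicate i 0))
  refine ⟨Submodule.span ℝ (Set.range v),
    FiniteDimensional.span_of_finite ℝ (Set.finite_range v),
    (finrank_range_le_card v).trans (by simpa using hnk), fun f hf => ?_⟩
  have hL : ∀ i < n, N.functional (List.replicate i 0) f = 0 := fun i hi => by
    have := hf (v ⟨i, hi⟩) (Submodule.subset_span ⟨_, rfl⟩)
    simpa [v, InnerProductSpace.toDual_symm_apply] using this
  have hmem : ∀ a : ℝ, List.replicate n (0 : ℝ) ∈ N.values (a • f) := fun a =>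
    N.mem_values_replicate hn _ fun i hi => by simp [hL i hi]
  rcases eq_or_ne f 0 with rfl | hf0
  · simp
  have hf' : 0 < ‖f‖ := norm_pos_iff.2 hf0
  have := norm_le_of_worstError_le (f := ‖f‖⁻¹ • f) hc h
    (by rw [norm_smul, norm_inv, norm_norm, inv_mul_cancel₀ hf'.ne']) (hmem _)
    (by rw [← neg_smul]; exact hmem _)
  rwa [map_smul, norm_smul, norm_inv, norm_norm, inv_mul_le_iff₀ hf', mul_comm] at this

end LowerBounds

/-! ### Comparison of complexities -/

section Families

variable {F G : ℕ+ → Type*} [∀ d, NormedAddCommGroup (F d)] [∀ d, InnerProductSpace ℝ (F d)]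
  [∀ d, NormedAddCommGroup (G d)] [∀ d, InnerProductSpace ℝ (G d)]

theorem exactComplexity_le_complexity (S : ∀ d, F d →L[ℝ] G d) (cost : CostFunction) (ε : ℝ)
    (d : ℕ+) : exactComplexity S ε d ≤ complexity S cost ε d :=
  iInf_mono fun N => iInf₂_mono fun _ _ => N.totalCost_unit_le cost d

theorem cost_le_complexity (S : ∀ d, F d →L[ℝ] G d) (cost : CostFunction) {ε : ℝ≥0} {d : ℕ+}
    (hS : S d ≠ 0) (hε : ε < 1) : cost ε d ≤ complexity S cost ε d :=
  le_iInf fun _ => le_iInf₂ fun _ h => cost_le_totalCost hS cost d hε h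

theorem exists_submodule_of_exactComplexity_le (S : ∀ d, F d →L[ℝ] G d) {d : ℕ+}
    [CompleteSpace (F d)] {ε X : ℝ} (hε : 0 ≤ ε) (hX : 0 ≤ X)
    (h : exactComplexity S ε d ≤ ENNReal.ofReal X) :
    ∃ V : Submodule ℝ (F d), FiniteDimensional ℝ V ∧ (Module.finrank ℝ V : ℝ) ≤ X ∧
      ∀ f ∈ Vᗮ, ‖S d f‖ ≤ ε * ‖S d‖ * ‖f‖ := by
  -- The infimum need not be attained; cost strictly below `⌊X⌋₊ + 1` suffices because the number of
  -- observations is an integer.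
  have hlt : exactComplexity S ε d < (⌊X⌋₊ : ℝ≥0∞) + 1 := by
    refine h.trans_lt ?_
    have := (ENNReal.ofReal_lt_ofReal_iff (by positivity)).2 (Nat.lt_floor_add_one X)
    rwa [ENNReal.ofReal_add (by positivity) zero_le_one, ENNReal.ofReal_natCast,
      ENNReal.ofReal_one] at this
  simp only [exactComplexity, complexity, iInf_lt_iff] at hlt
  obtain ⟨N, Φ, hN, hlt⟩ := hlt
  obtain ⟨V, h1, h2, h3⟩ := exists_submodule_of_totalCost_lt (by positivity) hN d hlt
  exact ⟨V, h1, (Nat.cast_le.2 h2).trans (Nat.floor_le hX), h3⟩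

end Families

/-! ### Linear algorithms from approximate singular vectors -/

section UpperBound

variable {F G : Type*} [NormedAddCommGroup F] [InnerProductSpace ℝ F]
  [NormedAddCommGroup G] [InnerProductSpace ℝ G]

theorem norm_sum_smul_sq_of_orthogonal {ι : Type*} {w : ι → G}
    (hw : Pairwise fun i j => inner ℝ (w i) (w j) = 0) (s : Finset ι) (a : ι → ℝ) :
    ‖∑ i ∈ s, a i • w i‖ ^ 2 = ∑ i ∈ s, a i ^ 2 * ‖w i‖ ^ 2 := by
  classical
  rw [← real_inner_self_eq_norm_sq, sum_inner]
  refine Finset.sum_congr rfl fun i hi => ?_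
  rw [inner_sum, Finset.sum_eq_single_of_mem i hi]
  · rw [real_inner_smul_left, real_inner_smul_right, real_inner_self_eq_norm_sq]; ring
  · intro j _ hj
    rw [real_inner_smul_left, real_inner_smul_right, hw hj.symm]; ring

/-- A finite-dimensional space has an orthonormal basis with pairwise orthogonal images. -/
theorem exists_orthonormalBasis_image_orthogonal [FiniteDimensional ℝ F] [CompleteSpace G]
    (T : F →L[ℝ] G) :
    ∃ b : OrthonormalBasis (Fin (Module.finrank ℝ F)) ℝ F,
      Pairwise fun i j => inner ℝ (T (b i)) (T (b j)) = 0 := by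
  have : CompleteSpace F := FiniteDimensional.complete ℝ F
  -- Eigenvectors of T*T work: ⟨T bᵢ, T bⱼ⟩ = ⟨T*T bᵢ, bⱼ⟩.
  have hsym : ((ContinuousLinearMap.adjoint T ∘L T : F →L[ℝ] F) : F →ₗ[ℝ] F).IsSymmetric :=
    fun x y => by
      simp [ContinuousLinearMap.adjoint_inner_left, ContinuousLinearMap.adjoint_inner_right]
  refine ⟨hsym.eigenvectorBasis rfl, fun i j hij => ?_⟩
  change inner ℝ (T _) (T _) = 0
  rw [← ContinuousLinearMap.adjoint_inner_left]
  have h := hsym.apply_eigenvectorBasis rfl i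
  simp only [ContinuousLinearMap.coe_coe, ContinuousLinearMap.comp_apply] at h
  rw [h, inner_smul_left, (hsym.eigenvectorBasis rfl).inner_eq_zero hij, mul_zero]

/-- If `S` is bounded by `c` on the orthogonal complement of `V`, then at most `dim V` of the
singular values of `S` exceed `c`. -/
theorem card_filter_lt_norm_le_finrank {S : F →L[ℝ] G} {V : Submodule ℝ F}
    [FiniteDimensional ℝ V] {c : ℝ} (hc : 0 ≤ c) (hV : ∀ f ∈ Vᗮ, ‖S f‖ ≤ c * ‖f‖)
    {ι : Type*} [Fintype ι] {e : ι → F} (he : Orthonormal ℝ e)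
    (hSe : Pairwise fun i j => inner ℝ (S (e i)) (S (e j)) = 0) :
    (Finset.univ.filter fun i => c < ‖S (e i)‖).card ≤ Module.finrank ℝ V := by
  classical
  set s := Finset.univ.filter fun i => c < ‖S (e i)‖ with hs
  by_contra! hlt
  let A : (s → ℝ) →ₗ[ℝ] F := Fintype.linearCombination ℝ fun i : s => e i
  -- With more than dim V vectors, some nontrivial combination lies in `Vᗮ`. There `S` is bounded by
  -- `c`, while orthogonality of the images makes it expand by more than `c`.
  have hker : (V.orthogonalProjectionOnto.toLinearMap ∘ₗ A).ker ≠ ⊥ :=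
    LinearMap.ker_ne_bot_of_finrank_lt (by simpa using hlt)
  obtain ⟨a, ha, ha0⟩ := Submodule.exists_mem_ne_zero_of_ne_bot hker
  have hA : A a = ∑ i : s, a i • e i := by simp [A, Fintype.linearCombination_apply]
  have hmem : A a ∈ Vᗮ := by
    rw [LinearMap.mem_ker] at ha
    exact Submodule.orthogonalProjectionOnto_eq_zero_iff.1 (by simpa using ha)
  have h1 := hV _ hmem
  have h2 : ‖A a‖ ^ 2 = ∑ i : s, a i ^ 2 := by
    rw [hA, norm_sum_smul_sq_of_orthogonal (w := fun i : s => e i)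
      fun i j hij => he.inner_eq_zero fun h => hij (Subtype.ext h)]
    simp [he.norm_eq_one]
  have h3 : ‖S (A a)‖ ^ 2 = ∑ i : s, a i ^ 2 * ‖S (e i)‖ ^ 2 := by
    rw [hA, map_sum]
    simp only [map_smul]
    exact norm_sum_smul_sq_of_orthogonal (w := fun i : s => S (e i))
      (fun i j hij => hSe fun h => hij (Subtype.ext h)) _ _
  have h4 : c ^ 2 * ∑ i : s, a i ^ 2 < ∑ i : s, a i ^ 2 * ‖S (e i)‖ ^ 2 := by
    rw [Finset.mul_sum]
    have hlt' : ∀ i : s, c ^ 2 < ‖S (e i)‖ ^ 2 := fun i =>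
      pow_lt_pow_left₀ (Finset.mem_filter.1 i.2).2 hc two_ne_zero
    obtain ⟨j, hj⟩ := Function.ne_iff.1 ha0
    refine Finset.sum_lt_sum (fun i _ => ?_) ⟨j, Finset.mem_univ _, ?_⟩
    · nlinarith [hlt' i, sq_nonneg (a i)]
    · nlinarith [hlt' j, sq_pos_of_ne_zero hj]
  have h5 := pow_le_pow_left₀ (norm_nonneg _) h1 2
  rw [mul_pow, h2, h3] at h5
  exact absurd h4 h5.not_gt

/-- Nonadaptive information that observes the coordinates of an orthonormal system. -/
noncomputable def Information.ofOrthonormal {m : ℕ} (e : Fin m → F) (he : Orthonormal ℝ e)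
    (σ : Fin m → ℝ≥0) : Information F where
  functional y := if h : y.length < m then innerSL ℝ (e ⟨y.length, h⟩) else 0
  norm_functional_le y := by
    split_ifs with h
    · rw [innerSL_apply_norm, he.norm_eq_one]
    · simp
  precision y := if h : y.length < m then σ ⟨y.length, h⟩ else 0
  Y := {y | y.length = m}
  terminates y := ⟨m, by simp, fun n hn => by simpa using hn⟩

theorem Information.totalCost_ofOrthonormal_le {m : ℕ} (e : Fin m → F) (he : Orthonormal ℝ e)
    (σ : Fin m → ℝ≥0) (cost : CostFunction) (d : ℕ+) :
    (Information.ofOrthonormal e he σ).totalCost cost d ≤ ∑ i, cost (σ i) d := by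
  refine iSup₂_le fun f _ => iSup₂_le fun y hy => ?_
  have hlen : y.length = m := hy.1
  rw [hlen, Finset.sum_range]
  refine Finset.sum_le_sum fun i _ => ?_
  simp [Information.ofOrthonormal, hlen]

/-- The error of the linear algorithm `y ↦ ∑ yᵢ S eᵢ`. -/
theorem exists_worstError_ofOrthonormal_le {S : F →L[ℝ] G} {V : Submodule ℝ F}
    [FiniteDimensional ℝ V] {c c' : ℝ} (hc : 0 ≤ c) (hV : ∀ f ∈ Vᗮ, ‖S f‖ ≤ c * ‖f‖) {m : ℕ}
    (b : OrthonormalBasis (Fin m) ℝ V)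
    (hb : Pairwise fun i j => inner ℝ (S (b i)) (S (b j)) = 0) (σ : Fin m → ℝ≥0)
    (he : Orthonormal ℝ fun i => (b i : F)) (hc' : 0 ≤ c')
    (hσ : ∑ i, (σ i : ℝ) ^ 2 * ‖S (b i)‖ ^ 2 ≤ c' ^ 2) :
    ∃ Φ : List ℝ → G, worstError S (Information.ofOrthonormal (fun i => (b i : F)) he σ) Φ ≤
      ENNReal.ofReal (c' + c) := by
  -- The default `0` is never read, since admissible lists have length `m`.
  refine ⟨fun y => ∑ i : Fin m, y.getD i 0 • S (b i), ?_⟩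
  refine iSup₂_le fun f hf => iSup₂_le fun y hy => ENNReal.ofReal_le_ofReal ?_
  have hlen : y.length = m := hy.1
  set P := V.starProjection f with hP
  have hPsum : P = ∑ i, inner ℝ (b i : F) f • (b i : F) := by
    have h := congrArg (Subtype.val) (b.sum_repr (V.orthogonalProjectionOnto f))
    rw [hP, Submodule.starProjection_apply, ← h]
    simp only [Submodule.coe_sum, Submodule.coe_smul, b.repr_apply_apply]
    refine Finset.sum_congr rfl fun i _ => ?_
    congr 1
    rw [Submodule.coe_inner, ← Submodule.starProjection_apply,
      ← Submodule.inner_starProjection_left_eq_right, Submodule.starProjection_eq_self_iff.2 (b i).2]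
  have h1 : ‖S (f - P)‖ ≤ c := by
    have hperp : f - P ∈ Vᗮ := Submodule.sub_starProjection_mem_orthogonal f
    have hle : ‖f - P‖ ≤ ‖f‖ := by
      have : f - P = Vᗮ.starProjection f := by
        rw [Submodule.starProjection_orthogonal_val]
      rw [this]
      exact Submodule.norm_starProjection_apply_le _ _
    calc _ ≤ c * ‖f - P‖ := hV _ hperp
      _ ≤ c * 1 := by gcongr; exact hle.trans hf
      _ = c := mul_one c
  have h2 : ‖S P - ∑ i : Fin m, y.getD i 0 • S (b i)‖ ≤ c' := by
    refine le_of_sq_le_sq ?_ hc'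
    have : S P - ∑ i : Fin m, y.getD i 0 • S (b i) =
        ∑ i : Fin m, (inner ℝ (b i : F) f - y.getD i 0) • S (b i) := by
      rw [hPsum, map_sum, ← Finset.sum_sub_distrib]
      simp only [map_smul, sub_smul]
    -- Pythagoras in the target space: the noise contributions add in squares, not in norm.
    rw [this, norm_sum_smul_sq_of_orthogonal hb]
    refine le_trans (Finset.sum_le_sum fun i _ => ?_) hσ
    refine mul_le_mul_of_nonneg_right ?_ (sq_nonneg _)
    have hi : (i : ℕ) < y.length := hlen ▸ i.2
    have := hy.2 i hi
    simp only [Information.ofOrthonormal, List.length_take, min_eq_left hi.le, i.2, dif_pos,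
      innerSL_apply_apply] at this
    rw [List.getD_eq_getElem _ _ hi, ← sq_abs, abs_sub_comm]
    exact pow_le_pow_left₀ (abs_nonneg _) this 2
  calc ‖S f - ∑ i : Fin m, y.getD i 0 • S (b i)‖
      = ‖(S P - ∑ i : Fin m, y.getD i 0 • S (b i)) + S (f - P)‖ := by rw [map_sub]; congr 1; abel
    _ ≤ _ := (norm_add_le _ _).trans (add_le_add h2 h1)

end UpperBound

/-! ### Choice of precisions and sums over singular values -/

section Allocation

variable {ι : Type*} [Fintype ι]

/-- The optimal allocation of precisions for the truncated singular values `max (lam i) ε`. -/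
theorem exists_precision (lam : ι → ℝ) (h0 : ∀ i, 0 ≤ lam i) {ε s : ℝ} (hε : 0 < ε) (hs : 0 ≤ s) :
    ∃ σ : ι → ℝ≥0, (∀ i, 0 < σ i) ∧ (∀ i, σ i < 1) ∧
      ∑ i, (σ i : ℝ) ^ 2 * lam i ^ 2 ≤ (ε / 2) ^ 2 ∧
      ∑ i, (σ i : ℝ) ^ (-(2 * s)) =
        (ε / 2) ^ (-(2 * s)) * (∑ i, max (lam i) ε ^ (2 * s / (s + 1))) ^ (s + 1) := by
  set μ : ι → ℝ := fun i => max (lam i) ε with hμ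
  have hμε : ∀ i, ε ≤ μ i := fun i => le_max_right _ _
  have hμ0 : ∀ i, 0 < μ i := fun i => hε.trans_le (hμε i)
  set T : ℝ := ∑ i, μ i ^ (2 * s / (s + 1)) with hT
  have hs1 : s + 1 ≠ 0 := by positivity
  have hterm : ∀ i, 0 < μ i ^ (2 * s / (s + 1)) := fun i => Real.rpow_pos_of_pos (hμ0 i) _
  rcases isEmpty_or_nonempty ι with hι | hι
  · exact ⟨fun _ => 1, by simp, by simp, by simp; positivity, by
      simp [hT, Real.zero_rpow hs1]⟩
  have hT0 : 0 < T := Finset.sum_pos (fun i _ => hterm i) Finset.univ_nonempty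
  -- Minimizing Σ σᵢ^(-2s) under Σ σᵢ²μᵢ² = (ε/2)² makes σᵢ^(-2s-2) proportional to μᵢ², so σᵢ is
  -- proportional to μᵢ^(-1/(s+1)); the power of `T` normalizes the constraint.
  let τ : ι → ℝ := fun i => ε / 2 * (μ i ^ (-(1 / (s + 1))) * T ^ (-(1 / 2 : ℝ)))
  have hτ0 : ∀ i, 0 < τ i := fun i =>
    mul_pos (by positivity) (mul_pos (Real.rpow_pos_of_pos (hμ0 i) _) (Real.rpow_pos_of_pos hT0 _))
  have hτsq : ∀ i, τ i ^ 2 * μ i ^ 2 = (ε / 2) ^ 2 * (μ i ^ (2 * s / (s + 1)) / T) := fun i => by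
    have e1 : (μ i ^ (-(1 / (s + 1)))) ^ 2 * μ i ^ 2 = μ i ^ (2 * s / (s + 1)) := by
      rw [← mul_pow, ← Real.rpow_add_one (hμ0 i).ne', ← Real.rpow_mul_natCast (hμ0 i).le]
      congr 1; push_cast; field_simp; ring
    have e2 : (T ^ (-(1 / 2 : ℝ))) ^ 2 = T⁻¹ := by
      rw [← Real.rpow_mul_natCast hT0.le, ← Real.rpow_neg_one]; norm_num
    calc τ i ^ 2 * μ i ^ 2
        = (ε / 2) ^ 2 * (((μ i ^ (-(1 / (s + 1)))) ^ 2 * μ i ^ 2) * (T ^ (-(1 / 2 : ℝ))) ^ 2) := by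
          simp only [τ]; ring
      _ = _ := by rw [e1, e2, div_eq_mul_inv (μ i ^ _) T]
  refine ⟨fun i => (⟨τ i, (hτ0 i).le⟩ : ℝ≥0), fun i => hτ0 i, fun i => ?_, ?_, ?_⟩
  -- A single term of the constraint gives τᵢμᵢ ≤ ε/2, and the truncation μᵢ ≥ ε then gives τᵢ ≤
  -- 1/2.
  · change τ i < 1
    have h1 : μ i ^ (2 * s / (s + 1)) / T ≤ 1 := (div_le_one hT0).2
      (Finset.single_le_sum (f := fun i => μ i ^ (2 * s / (s + 1)))
        (fun i _ => (hterm i).le) (Finset.mem_univ i))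
    have h2 : (τ i * μ i) ^ 2 ≤ (ε / 2) ^ 2 := by
      rw [mul_pow, hτsq]
      exact mul_le_of_le_one_right (sq_nonneg _) h1
    have h3 : τ i * μ i ≤ ε / 2 := le_of_sq_le_sq h2 (by positivity)
    nlinarith [mul_le_mul_of_nonneg_left (hμε i) (hτ0 i).le]
  · calc ∑ i, τ i ^ 2 * lam i ^ 2 ≤ ∑ i, τ i ^ 2 * μ i ^ 2 := by
          refine Finset.sum_le_sum fun i _ => ?_
          gcongr
          · exact h0 i
          · exact le_max_left _ _
      _ = (ε / 2) ^ 2 := by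
          simp only [hτsq]
          rw [← Finset.mul_sum, ← Finset.sum_div, div_self hT0.ne', mul_one]
  · have hpow : ∀ i, τ i ^ (-(2 * s)) =
        (ε / 2) ^ (-(2 * s)) * T ^ s * μ i ^ (2 * s / (s + 1)) := fun i => by
      simp only [τ]
      have p1 := Real.rpow_pos_of_pos (hμ0 i) (-(1 / (s + 1)))
      have p2 := Real.rpow_pos_of_pos hT0 (-(1 / 2 : ℝ))
      rw [Real.mul_rpow (by positivity) (by positivity), Real.mul_rpow p1.le p2.le,
        ← Real.rpow_mul (hμ0 i).le, ← Real.rpow_mul hT0.le]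
      rw [show -(1 / (s + 1)) * -(2 * s) = 2 * s / (s + 1) by ring,
        show -(1 / 2 : ℝ) * -(2 * s) = s by ring]
      ring
    change ∑ i, τ i ^ (-(2 * s)) = _
    simp only [hpow]
    rw [← Finset.mul_sum, ← hT, Real.rpow_add_one hT0.ne', mul_assoc]

/-- `lam` are numbers in `[0, 1]` such that at most `X * η ^ (-p)` of them exceed `η`, and whose
number is at most `X * (ε / 2) ^ (-p)`. -/
structure PolynomialDecay (X p ε : ℝ) (lam : ι → ℝ) : Prop where
  le_one : ∀ i, lam i ≤ 1
  card_le : (Fintype.card ι : ℝ) ≤ X * (ε / 2) ^ (-p)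
  card_lt_le : ∀ η, 0 < η → η < 1 → ((Finset.univ.filter fun i => η < lam i).card : ℝ) ≤
    X * η ^ (-p)

/-- Dyadic bound of a sum of powers of truncated singular values. -/
theorem PolynomialDecay.sum_rpow_le {X p ε : ℝ} {lam : ι → ℝ} (h : PolynomialDecay X p ε lam)
    (hX : 0 ≤ X) (hp : 0 ≤ p) (hε : 0 < ε) (hε1 : ε < 1) {r : ℝ} (hr : 0 ≤ r) :
    ∃ K : ℕ, ε ≤ (1 / 2) ^ K ∧
      ∑ i, max (lam i) ε ^ r ≤ X * 4 ^ p * ∑ k ∈ Finset.range (K + 1), ((2 : ℝ) ^ (p - r)) ^ k := by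
  classical
  set μ : ι → ℝ := fun i => max (lam i) ε with hμ
  have hμε : ∀ i, ε ≤ μ i := fun i => le_max_right _ _
  have hμ0 : ∀ i, 0 < μ i := fun i => hε.trans_le (hμε i)
  obtain ⟨K, hK1, hK2⟩ := exists_nat_pow_near_of_lt_one hε hε1.le
    (by norm_num : (0 : ℝ) < 1 / 2) (by norm_num)
  refine ⟨K, hK2, ?_⟩
  have hcount : ∀ k : ℕ,
      ((Finset.univ.filter fun i => (1 / 2 : ℝ) ^ (k + 1) < μ i).card : ℝ) ≤
        X * 4 ^ p * ((2 : ℝ) ^ p) ^ k := fun k => by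
    -- The exponent `k + 2` serves both cases below: if ε ≤ 2^(-k-1), the decay bound at that level
    -- applies; otherwise ε/2 ≥ 2^(-k-2) and the bound on the total number suffices.
    have hη : ((1 / 2 : ℝ) ^ (k + 2)) ^ (-p) = 4 ^ p * ((2 : ℝ) ^ p) ^ k := by
      rw [one_div, inv_pow, Real.rpow_neg (by positivity), Real.inv_rpow (by positivity), inv_inv,
        ← Real.rpow_natCast ((2 : ℝ) ^ p), ← Real.rpow_mul (by norm_num), mul_comm p,
        Real.rpow_mul (by norm_num), Real.rpow_natCast, ← Real.mul_rpow (by norm_num) (by positivity)]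
      congr 1; ring
    have hmono : ∀ x : ℝ, (1 / 2 : ℝ) ^ (k + 2) ≤ x →
        X * x ^ (-p) ≤ X * 4 ^ p * ((2 : ℝ) ^ p) ^ k := fun x hx => by
      rw [mul_assoc, ← hη]
      exact mul_le_mul_of_nonneg_left
        (Real.rpow_le_rpow_of_nonpos (by positivity) hx (by linarith)) hX
    rcases le_or_gt ε ((1 / 2) ^ (k + 1)) with hk | hk
    · refine le_trans ?_ ((h.card_lt_le ((1 / 2) ^ (k + 1)) (by positivity)
        (pow_lt_one₀ (by norm_num) (by norm_num) (by omega))).trans (hmono _ ?_))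
      · refine Nat.cast_le.2 (Finset.card_le_card fun i hi => ?_)
        simp only [Finset.mem_filter, Finset.mem_univ, true_and, μ, lt_max_iff] at hi ⊢
        exact hi.resolve_right hk.not_gt
      · exact pow_le_pow_of_le_one (by norm_num) (by norm_num) (by omega)
    · refine le_trans (Nat.cast_le.2 (Finset.card_le_univ _)) (h.card_le.trans (hmono _ ?_))
      rw [pow_succ]; linarith
  -- The term of the dyadic interval (2^(-k-1), 2^(-k)] containing μᵢ already bounds its power; k ≤
  -- K because μᵢ ≥ ε > 2^(-K-1).
  have hpt : ∀ i, μ i ^ r ≤ ∑ k ∈ Finset.range (K + 1),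
      if (1 / 2 : ℝ) ^ (k + 1) < μ i then ((2 : ℝ) ^ (-r)) ^ k else 0 := fun i => by
    obtain ⟨k, hk1, hk2⟩ := exists_nat_pow_near_of_lt_one (hμ0 i) (max_le (h.le_one i) hε1.le)
      (by norm_num : (0 : ℝ) < 1 / 2) (by norm_num)
    have hkK : k < K + 1 := by
      by_contra! hcon
      have : (1 / 2 : ℝ) ^ k ≤ (1 / 2) ^ (K + 1) :=
        pow_le_pow_of_le_one (by norm_num) (by norm_num) hcon
      linarith [hμε i]
    refine le_trans ?_ (Finset.single_le_sum (f := fun k : ℕ =>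
      if (1 / 2 : ℝ) ^ (k + 1) < μ i then ((2 : ℝ) ^ (-r)) ^ k else 0)
      (fun k _ => by positivity) (Finset.mem_range.2 hkK))
    simp only [hk1, if_true]
    refine (Real.rpow_le_rpow (hμ0 i).le hk2 hr).trans (le_of_eq ?_)
    rw [one_div, inv_pow, Real.inv_rpow (by positivity), Real.rpow_neg (by norm_num), inv_pow,
      ← Real.rpow_natCast, ← Real.rpow_natCast, ← Real.rpow_mul (by norm_num),
      ← Real.rpow_mul (by norm_num), mul_comm]
  calc ∑ i, μ i ^ r ≤ ∑ i, ∑ k ∈ Finset.range (K + 1),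
        (if (1 / 2 : ℝ) ^ (k + 1) < μ i then ((2 : ℝ) ^ (-r)) ^ k else 0) :=
        Finset.sum_le_sum fun i _ => hpt i
    _ = ∑ k ∈ Finset.range (K + 1),
        ((Finset.univ.filter fun i => (1 / 2 : ℝ) ^ (k + 1) < μ i).card : ℝ) *
          ((2 : ℝ) ^ (-r)) ^ k := by
        rw [Finset.sum_comm]
        refine Finset.sum_congr rfl fun k _ => ?_
        rw [← Finset.sum_filter, Finset.sum_const, nsmul_eq_mul]
    _ ≤ ∑ k ∈ Finset.range (K + 1), X * 4 ^ p * ((2 : ℝ) ^ p) ^ k * ((2 : ℝ) ^ (-r)) ^ k :=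
        Finset.sum_le_sum fun k _ => mul_le_mul_of_nonneg_right (hcount k) (by positivity)
    _ = _ := by
        rw [Finset.mul_sum]
        refine Finset.sum_congr rfl fun k _ => ?_
        rw [mul_assoc, ← mul_pow, ← Real.rpow_add (by norm_num), ← sub_eq_add_neg]

/-- The geometric ratio exceeds one, so the last term governs the sum, and ε ≤ 2^(-K) bounds it. -/
theorem PolynomialDecay.sum_rpow_le_of_lt {X p ε : ℝ} {lam : ι → ℝ}
    (h : PolynomialDecay X p ε lam) (hX : 0 ≤ X) (hp : 0 ≤ p) (hε : 0 < ε) (hε1 : ε < 1) {r : ℝ}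
    (hr : 0 ≤ r) (hrp : r < p) :
    ∑ i, max (lam i) ε ^ r ≤
      4 ^ p * (2 ^ (p - r) / (2 ^ (p - r) - 1)) * X * ε ^ (-(p - r)) := by
  obtain ⟨K, hK, hle⟩ := h.sum_rpow_le hX hp hε hε1 hr
  have h1 : (1 : ℝ) < 2 ^ (p - r) := Real.one_lt_rpow (by norm_num) (by linarith)
  have h2 : ((2 : ℝ) ^ (p - r)) ^ K ≤ ε ^ (-(p - r)) := by
    refine le_trans (le_of_eq ?_) (Real.rpow_le_rpow_of_nonpos hε hK (by linarith))
    rw [one_div, inv_pow, Real.rpow_neg (by positivity), Real.inv_rpow (by positivity), inv_inv,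
      ← Real.rpow_natCast, ← Real.rpow_natCast, ← Real.rpow_mul (by norm_num),
      ← Real.rpow_mul (by norm_num), mul_comm]
  have h3 : (0 : ℝ) < 2 ^ (p - r) - 1 := by linarith
  refine hle.trans ?_
  rw [geom_sum_eq h1.ne']
  calc X * 4 ^ p * ((((2 : ℝ) ^ (p - r)) ^ (K + 1) - 1) / (2 ^ (p - r) - 1))
      ≤ X * 4 ^ p * ((ε ^ (-(p - r)) * 2 ^ (p - r)) / (2 ^ (p - r) - 1)) := by
        gcongr
        rw [pow_succ]
        nlinarith
    _ = _ := by ring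

/-- The ratio is one, so each of the K + 1 dyadic levels contributes equally; counting levels
produces the logarithm. -/
theorem PolynomialDecay.sum_rpow_le_of_eq {X p ε : ℝ} {lam : ι → ℝ}
    (h : PolynomialDecay X p ε lam) (hX : 0 ≤ X) (hp : 0 ≤ p) (hε : 0 < ε) (hε1 : ε < 1) :
    ∑ i, max (lam i) ε ^ p ≤ 4 ^ p * (1 / Real.log 2) * X * (1 + Real.log (1 / ε)) := by
  obtain ⟨K, hK, hle⟩ := h.sum_rpow_le hX hp hε hε1 hp
  have hl0 : 0 < Real.log 2 := Real.log_pos (by norm_num)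
  have hl1 : Real.log 2 ≤ 1 := Real.log_two_lt_d9.le.trans (by norm_num)
  have h1 : K * Real.log 2 ≤ Real.log (1 / ε) := by
    rw [← Real.log_pow]
    refine Real.log_le_log (by positivity) ?_
    rw [le_div_iff₀ hε]
    calc (2 : ℝ) ^ K * ε ≤ 2 ^ K * (1 / 2) ^ K := by gcongr
      _ = 1 := by rw [← mul_pow]; norm_num
  refine hle.trans ?_
  simp only [sub_self, Real.rpow_zero, one_pow, Finset.sum_const, Finset.card_range, nsmul_eq_mul,
    mul_one]
  calc X * 4 ^ p * ((K + 1 : ℕ) : ℝ)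
      ≤ X * 4 ^ p * ((1 / Real.log 2) * (1 + Real.log (1 / ε))) := by
        gcongr
        rw [one_div_mul_eq_div, le_div_iff₀ hl0]
        push_cast
        linarith
    _ = _ := by ring

/-- The ratio is below one, and the full geometric series bounds the sum uniformly in ε. -/
theorem PolynomialDecay.sum_rpow_le_of_gt {X p ε : ℝ} {lam : ι → ℝ}
    (h : PolynomialDecay X p ε lam) (hX : 0 ≤ X) (hp : 0 ≤ p) (hε : 0 < ε) (hε1 : ε < 1) {r : ℝ}
    (hr : 0 ≤ r) (hpr : p < r) :
    ∑ i, max (lam i) ε ^ r ≤ 4 ^ p * (1 - (2 : ℝ) ^ (p - r))⁻¹ * X * 1 := by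
  obtain ⟨K, -, hle⟩ := h.sum_rpow_le hX hp hε hε1 hr
  have h1 : (2 : ℝ) ^ (p - r) < 1 := Real.rpow_lt_one_of_one_lt_of_neg (by norm_num) (by linarith)
  have h0 : (0 : ℝ) < 2 ^ (p - r) := by positivity
  refine hle.trans ?_
  calc X * 4 ^ p * ∑ k ∈ Finset.range (K + 1), ((2 : ℝ) ^ (p - r)) ^ k
      ≤ X * 4 ^ p * (1 - (2 : ℝ) ^ (p - r))⁻¹ := by
        gcongr
        rw [← tsum_geometric_of_lt_one h0.le h1]
        exact (summable_geometric_of_lt_one h0.le h1).sum_le_tsum _ fun _ _ => by positivity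
    _ = _ := by ring

end Allocation

/-! ### Complexity bounds and their rates -/

section Tractability

variable {F G : ℕ+ → Type*} [∀ d, NormedAddCommGroup (F d)] [∀ d, InnerProductSpace ℝ (F d)]
  [∀ d, CompleteSpace (F d)] [∀ d, NormedAddCommGroup (G d)] [∀ d, InnerProductSpace ℝ (G d)]
  [∀ d, CompleteSpace (G d)]

/-- Observing the coordinates with respect to approximate singular vectors of `S d`. -/
theorem exists_decay_and_complexity_le_sum (S : ∀ d, F d →L[ℝ] G d) (cost : CostFunction) {d : ℕ+}
    (hS : S d ≠ 0) {X p ε : ℝ} (hX : 0 ≤ X)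
    (h : ∀ η : ℝ, 0 < η → η < 1 → exactComplexity S η d ≤ ENNReal.ofReal (X * η ^ (-p)))
    (hε : 0 < ε) (hε1 : ε < 1) :
    ∃ (m : ℕ) (lam : Fin m → ℝ), (∀ i, 0 ≤ lam i) ∧ PolynomialDecay X p ε lam ∧
      ∀ σ : Fin m → ℝ≥0, ∑ i, (σ i : ℝ) ^ 2 * lam i ^ 2 ≤ (ε / 2) ^ 2 →
        complexity S cost ε d ≤ ∑ i, cost (σ i) d := by
  have hS' : 0 < ‖S d‖ := norm_pos_iff.2 hS
  obtain ⟨V, hVfin, hVdim, hV⟩ := exists_submodule_of_exactComplexity_le S (by positivity)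
    (by positivity) (h (ε / 2) (by positivity) (by linarith))
  obtain ⟨b, hb⟩ := exists_orthonormalBasis_image_orthogonal ((S d).comp V.subtypeL)
  simp only [ContinuousLinearMap.comp_apply, Submodule.subtypeL_apply] at hb
  have he : Orthonormal ℝ fun i => (b i : F d) := by
    have := b.orthonormal.comp_linearIsometry V.subtypeₗᵢ
    exact this
  refine ⟨_, fun i => ‖S d (b i)‖ / ‖S d‖, fun i => by positivity, ⟨fun i => ?_, ?_, ?_⟩, ?_⟩
  · rw [div_le_one hS']
    exact (S d).unit_le_opNorm _ (he.norm_eq_one i).le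
  · simpa using hVdim
  · intro η hη hη1
    obtain ⟨W, hWfin, hWdim, hW⟩ :=
      exists_submodule_of_exactComplexity_le S hη.le (by positivity) (h η hη hη1)
    refine le_trans (Nat.cast_le.2 ?_) hWdim
    simp only [lt_div_iff₀ hS']
    -- The vectors come from the subspace for ε/2, yet they are counted against the subspace `W` for
    -- η.
    exact card_filter_lt_norm_le_finrank (by positivity) hW he hb
  · intro σ hσ
    have hσ' : ∑ i, (σ i : ℝ) ^ 2 * ‖S d (b i)‖ ^ 2 ≤ (ε / 2 * ‖S d‖) ^ 2 := by
      rw [mul_pow, ← div_le_iff₀ (by positivity), Finset.sum_div]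
      refine le_trans (le_of_eq (Finset.sum_congr rfl fun i _ => ?_)) hσ
      rw [div_pow, mul_div_assoc]
    obtain ⟨Φ, hΦ⟩ := exists_worstError_ofOrthonormal_le (by positivity) hV b hb σ he
      (by positivity) hσ'
    refine le_trans (iInf_le_of_le _ (iInf₂_le_of_le Φ ?_ le_rfl))
      (Information.totalCost_ofOrthonormal_le _ he σ cost d)
    rwa [← add_mul, add_halves] at hΦ

/-- The summand `1` in the price bound counts the observations; the growth term is summed with the
optimal precisions. -/
theorem exists_decay_and_complexity_le (S : ∀ d, F d →L[ℝ] G d) (cost : CostFunction) {d : ℕ+}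
    (hS : S d ≠ 0) {X p ε E s : ℝ} (hX : 0 ≤ X)
    (h : ∀ η : ℝ, 0 < η → η < 1 → exactComplexity S η d ≤ ENNReal.ofReal (X * η ^ (-p)))
    (hE : 0 ≤ E) (hs : 0 ≤ s)
    (hcost : ∀ σ : ℝ≥0, 0 < σ → σ < 1 →
      cost σ d ≤ 1 + ENNReal.ofReal (E * (σ : ℝ) ^ (-(2 * s))))
    (hε : 0 < ε) (hε1 : ε < 1) :
    ∃ (m : ℕ) (lam : Fin m → ℝ), PolynomialDecay X p ε lam ∧
      complexity S cost ε d ≤ ENNReal.ofReal (X * (ε / 2) ^ (-p) +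
        E * ((ε / 2) ^ (-(2 * s)) * (∑ i, max (lam i) ε ^ (2 * s / (s + 1))) ^ (s + 1))) := by
  obtain ⟨m, lam, h0, hlam, hle⟩ := exists_decay_and_complexity_le_sum S cost hS hX h hε hε1
  obtain ⟨σ, hσ0, hσ1, hσ2, hσ3⟩ := exists_precision lam h0 hε hs
  refine ⟨m, lam, hlam, (hle σ hσ2).trans ?_⟩
  calc ∑ i, cost (σ i) d
      ≤ ∑ i, ENNReal.ofReal (1 + E * (σ i : ℝ) ^ (-(2 * s))) := by
        refine Finset.sum_le_sum fun i _ => (hcost _ (hσ0 i) (hσ1 i)).trans (le_of_eq ?_)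
        rw [ENNReal.ofReal_add zero_le_one (by positivity), ENNReal.ofReal_one]
    _ = ENNReal.ofReal (∑ i, (1 + E * (σ i : ℝ) ^ (-(2 * s)))) :=
        (ENNReal.ofReal_sum_of_nonneg fun i _ => by positivity).symm
    _ ≤ _ := by
        refine ENNReal.ofReal_le_ofReal ?_
        rw [Finset.sum_add_distrib, ← Finset.mul_sum, hσ3]
        have := hlam.card_le
        simp only [Finset.sum_const, Finset.card_univ, nsmul_eq_mul, mul_one]
        linarith

/-- Common core of all regimes: `g` is the growth in ε of the sum of truncated powers, and `hgp`
lets the main term absorb the number of observations. -/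
theorem dominated_of_sum_rpow_le (S : ∀ d, F d →L[ℝ] G d) (hS : ∀ d, S d ≠ 0)
    (cost : CostFunction) {C q p D t s : ℝ} (hC : 0 ≤ C) (hq : 0 ≤ q) (hD : 0 ≤ D) (ht : 0 ≤ t)
    (hs : 0 ≤ s)
    (hexact : ∀ d : ℕ+, ∀ ε : ℝ, 0 < ε → ε < 1 →
      exactComplexity S ε d ≤ ENNReal.ofReal (C * (d : ℝ) ^ q * ε ^ (-p)))
    (hcost : ∀ d : ℕ+, ∀ σ : ℝ≥0, 0 < σ → σ < 1 →
      cost σ d ≤ 1 + ENNReal.ofReal (D * (d : ℝ) ^ t * (σ : ℝ) ^ (-(2 * s))))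
    {B : ℝ} (hB : 0 ≤ B) (g : ℝ → ℝ) (hg : ∀ ε : ℝ, 0 < ε → ε < 1 → 0 ≤ g ε)
    (hgp : ∀ ε : ℝ, 0 < ε → ε < 1 → ε ^ (-p) ≤ ε ^ (-(2 * s)) * g ε ^ (s + 1))
    (hsum : ∀ (X ε : ℝ) (m : ℕ) (lam : Fin m → ℝ), 0 ≤ X → 0 < ε → ε < 1 →
      PolynomialDecay X p ε lam → ∑ i, max (lam i) ε ^ (2 * s / (s + 1)) ≤ B * X * g ε) :
    Dominated (complexity S cost) fun ε d =>
      (d : ℝ) ^ (t + q * (s + 1)) * (ε ^ (-(2 * s)) * g ε ^ (s + 1)) := by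
  refine ⟨C * 2 ^ p + D * 2 ^ (2 * s) * (B * C) ^ (s + 1), by positivity, fun d ε hε hε1 => ?_⟩
  have hd1 : (1 : ℝ) ≤ d := by exact_mod_cast (one_le : 1 ≤ d)
  have hd0 : (0 : ℝ) < d := by linarith
  obtain ⟨m, lam, hlam, hle⟩ := exists_decay_and_complexity_le S cost (hS d) (by positivity)
    (hexact d) (by positivity) hs (hcost d) hε hε1
  refine hle.trans (ENNReal.ofReal_le_ofReal ?_)
  have hT := hsum _ _ _ _ (by positivity) hε hε1 hlam
  have hT0 : 0 ≤ ∑ i, max (lam i) ε ^ (2 * s / (s + 1)) :=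
    Finset.sum_nonneg fun i _ => Real.rpow_nonneg (hε.le.trans (le_max_right _ _)) _
  have hgε := hg ε hε hε1
  have hhalf : ∀ x : ℝ, (ε / 2) ^ (-x) = 2 ^ x * ε ^ (-x) := fun x => by
    rw [Real.div_rpow hε.le (by norm_num), Real.rpow_neg (by norm_num : (0 : ℝ) ≤ 2),
      div_inv_eq_mul, mul_comm]
  have hdq : (d : ℝ) ^ q ≤ (d : ℝ) ^ (t + q * (s + 1)) :=
    Real.rpow_le_rpow_of_exponent_le hd1 (by nlinarith)
  have hTs : (∑ i, max (lam i) ε ^ (2 * s / (s + 1))) ^ (s + 1) ≤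
      (B * C) ^ (s + 1) * (d : ℝ) ^ (q * (s + 1)) * g ε ^ (s + 1) := by
    refine (Real.rpow_le_rpow hT0 hT (by positivity)).trans (le_of_eq ?_)
    rw [← mul_assoc, Real.mul_rpow (by positivity) hgε, Real.mul_rpow (by positivity) (by positivity),
      ← Real.rpow_mul hd0.le]
  rw [hhalf, hhalf]
  calc C * (d : ℝ) ^ q * (2 ^ p * ε ^ (-p)) + D * (d : ℝ) ^ t * (2 ^ (2 * s) * ε ^ (-(2 * s)) *
        (∑ i, max (lam i) ε ^ (2 * s / (s + 1))) ^ (s + 1))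
      ≤ C * (d : ℝ) ^ (t + q * (s + 1)) * (2 ^ p * (ε ^ (-(2 * s)) * g ε ^ (s + 1))) +
        D * (d : ℝ) ^ t * (2 ^ (2 * s) * ε ^ (-(2 * s)) *
          ((B * C) ^ (s + 1) * (d : ℝ) ^ (q * (s + 1)) * g ε ^ (s + 1))) := by
        have := hgp ε hε hε1
        gcongr
    _ = _ := by simp only [Real.rpow_add hd0 t]; ring

/-- The exponent in the sum is zero, so the sum is just the cardinality; bounding it directly avoids
the logarithm that the dyadic argument would give. -/
theorem dominated_of_zero (S : ∀ d, F d →L[ℝ] G d) (hS : ∀ d, S d ≠ 0)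
    (cost : CostFunction) {C q D t : ℝ} (hC : 0 ≤ C) (hq : 0 ≤ q) (hD : 0 ≤ D) (ht : 0 ≤ t)
    (hexact : ∀ d : ℕ+, ∀ ε : ℝ, 0 < ε → ε < 1 →
      exactComplexity S ε d ≤ ENNReal.ofReal (C * (d : ℝ) ^ q * ε ^ (-0 : ℝ)))
    (hcost : ∀ d : ℕ+, ∀ σ : ℝ≥0, 0 < σ → σ < 1 →
      cost σ d ≤ 1 + ENNReal.ofReal (D * (d : ℝ) ^ t * (σ : ℝ) ^ (-(2 * 0) : ℝ))) :
    Dominated (complexity S cost) fun _ d => (d : ℝ) ^ (t + q) := by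
  have := dominated_of_sum_rpow_le S hS cost hC hq hD ht le_rfl hexact hcost zero_le_one
    (fun _ => 1) (by simp) (by simp) fun X ε m lam _ _ _ h => by simpa using h.card_le
  simpa using this

theorem dominated_of_lt (S : ∀ d, F d →L[ℝ] G d) (hS : ∀ d, S d ≠ 0)
    (cost : CostFunction) {C q p D t s : ℝ} (hC : 0 ≤ C) (hq : 0 ≤ q) (hp : 0 ≤ p) (hD : 0 ≤ D)
    (ht : 0 ≤ t) (hs : 0 ≤ s)
    (hexact : ∀ d : ℕ+, ∀ ε : ℝ, 0 < ε → ε < 1 →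
      exactComplexity S ε d ≤ ENNReal.ofReal (C * (d : ℝ) ^ q * ε ^ (-p)))
    (hcost : ∀ d : ℕ+, ∀ σ : ℝ≥0, 0 < σ → σ < 1 →
      cost σ d ≤ 1 + ENNReal.ofReal (D * (d : ℝ) ^ t * (σ : ℝ) ^ (-(2 * s))))
    (hlt : 2 * s < p * (s + 1)) :
    Dominated (complexity S cost) fun ε d =>
      (d : ℝ) ^ (t + q * (s + 1)) * ε ^ (-(p * (s + 1))) := by
  have hs1 : 0 < s + 1 := by linarith
  have hr : 2 * s / (s + 1) < p := (div_lt_iff₀ hs1).2 hlt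
  -- The factor ε^(-2s) cancels exactly against the subtracted exponent, since (2s/(s+1))(s+1) = 2s.
  have hpow : ∀ ε : ℝ, 0 < ε → ε ^ (-(2 * s)) * (ε ^ (-(p - 2 * s / (s + 1)))) ^ (s + 1) =
      ε ^ (-(p * (s + 1))) := fun ε hε => by
    rw [← Real.rpow_mul hε.le, ← Real.rpow_add hε]
    congr 1; field_simp; ring
  have h2 : (1 : ℝ) < 2 ^ (p - 2 * s / (s + 1)) :=
    Real.one_lt_rpow (by norm_num) (by linarith)
  have hB : 0 ≤ (4 : ℝ) ^ p * (2 ^ (p - 2 * s / (s + 1)) / (2 ^ (p - 2 * s / (s + 1)) - 1)) :=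
    mul_nonneg (by positivity) (div_nonneg (by positivity) (by linarith))
  obtain ⟨A, hA, h⟩ := dominated_of_sum_rpow_le S hS cost hC hq hD ht hs hexact hcost hB
    (fun ε => ε ^ (-(p - 2 * s / (s + 1)))) (fun ε hε _ => by positivity)
    (fun ε hε hε1 => by
      rw [hpow ε hε]
      exact Real.rpow_le_rpow_of_exponent_ge hε hε1.le (by nlinarith))
    (fun X ε m lam hX hε hε1 h => h.sum_rpow_le_of_lt hX hp hε hε1 (by positivity) hr)
  exact ⟨A, hA, fun d ε hε hε1 => by simpa only [hpow ε hε] using h d ε hε hε1⟩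

theorem dominated_of_eq (S : ∀ d, F d →L[ℝ] G d) (hS : ∀ d, S d ≠ 0)
    (cost : CostFunction) {C q p D t s : ℝ} (hC : 0 ≤ C) (hq : 0 ≤ q) (hp : 0 ≤ p) (hD : 0 ≤ D)
    (ht : 0 ≤ t) (hs : 0 ≤ s)
    (hexact : ∀ d : ℕ+, ∀ ε : ℝ, 0 < ε → ε < 1 →
      exactComplexity S ε d ≤ ENNReal.ofReal (C * (d : ℝ) ^ q * ε ^ (-p)))
    (hcost : ∀ d : ℕ+, ∀ σ : ℝ≥0, 0 < σ → σ < 1 →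
      cost σ d ≤ 1 + ENNReal.ofReal (D * (d : ℝ) ^ t * (σ : ℝ) ^ (-(2 * s))))
    (heq : p * (s + 1) = 2 * s) :
    Dominated (complexity S cost) fun ε d =>
      (d : ℝ) ^ (t + q * (s + 1)) *
        ((1 + Real.log (1 / ε)) ^ (s + 1) * ε ^ (-(2 * s))) := by
  have hs1 : 0 < s + 1 := by linarith
  have hr : 2 * s / (s + 1) = p := (div_eq_iff hs1.ne').2 heq.symm
  have hlog : ∀ ε : ℝ, 0 < ε → ε < 1 → 0 ≤ Real.log (1 / ε) := fun ε hε hε1 =>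
    Real.log_nonneg ((one_le_div hε).2 hε1.le)
  have hl2 : 0 < Real.log 2 := Real.log_pos (by norm_num)
  have := dominated_of_sum_rpow_le S hS cost hC hq hD ht hs hexact hcost
    (B := 4 ^ p * (1 / Real.log 2)) (by positivity)
    (fun ε => 1 + Real.log (1 / ε)) (fun ε hε hε1 => by linarith [hlog ε hε hε1])
    (fun ε hε hε1 => by
      have h1 : ε ^ (-p) ≤ ε ^ (-(2 * s)) :=
        Real.rpow_le_rpow_of_exponent_ge hε hε1.le (by nlinarith)
      refine h1.trans (le_mul_of_one_le_right (by positivity) ?_)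
      exact Real.one_le_rpow (by linarith [hlog ε hε hε1]) hs1.le)
    (fun X ε m lam hX hε hε1 h => by
      rw [hr]
      exact h.sum_rpow_le_of_eq hX hp hε hε1)
  simpa only [mul_comm (_ ^ (-(2 * s))) _] using this

theorem dominated_of_gt (S : ∀ d, F d →L[ℝ] G d) (hS : ∀ d, S d ≠ 0)
    (cost : CostFunction) {C q p D t s : ℝ} (hC : 0 ≤ C) (hq : 0 ≤ q) (hp : 0 ≤ p) (hD : 0 ≤ D)
    (ht : 0 ≤ t) (hs : 0 ≤ s)
    (hexact : ∀ d : ℕ+, ∀ ε : ℝ, 0 < ε → ε < 1 →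
      exactComplexity S ε d ≤ ENNReal.ofReal (C * (d : ℝ) ^ q * ε ^ (-p)))
    (hcost : ∀ d : ℕ+, ∀ σ : ℝ≥0, 0 < σ → σ < 1 →
      cost σ d ≤ 1 + ENNReal.ofReal (D * (d : ℝ) ^ t * (σ : ℝ) ^ (-(2 * s))))
    (hgt : p * (s + 1) < 2 * s) :
    Dominated (complexity S cost) fun ε d =>
      (d : ℝ) ^ (t + q * (s + 1)) * ε ^ (-(2 * s)) := by
  have hs1 : 0 < s + 1 := by linarith
  have hr : p < 2 * s / (s + 1) := (lt_div_iff₀ hs1).2 hgt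
  have h2 : (2 : ℝ) ^ (p - 2 * s / (s + 1)) < 1 :=
    Real.rpow_lt_one_of_one_lt_of_neg (by norm_num) (by linarith)
  have hB : 0 ≤ (4 : ℝ) ^ p * (1 - (2 : ℝ) ^ (p - 2 * s / (s + 1)))⁻¹ :=
    mul_nonneg (by positivity) (inv_nonneg.2 (by linarith))
  have := dominated_of_sum_rpow_le S hS cost hC hq hD ht hs hexact hcost hB
    (fun _ => 1) (fun _ _ _ => zero_le_one)
    (fun ε hε hε1 => by
      rw [Real.one_rpow, mul_one]
      exact Real.rpow_le_rpow_of_exponent_ge hε hε1.le (by nlinarith))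
    (fun X ε m lam hX hε hε1 h => h.sum_rpow_le_of_gt hX hp hε hε1 (by positivity) hr)
  simpa only [Real.one_rpow, mul_one] using this

/-- The upper bound that gives tractability for noisy information. -/
theorem exists_complexity_le (S : ∀ d, F d →L[ℝ] G d) (hS : ∀ d, S d ≠ 0)
    (cost : CostFunction) {C q p D t s : ℝ} (hC : 0 ≤ C) (hq : 0 ≤ q) (hD : 0 ≤ D)
    (ht : 0 ≤ t) (hs : 0 ≤ s)
    (hexact : ∀ d : ℕ+, ∀ ε : ℝ, 0 < ε → ε < 1 →
      exactComplexity S ε d ≤ ENNReal.ofReal (C * (d : ℝ) ^ q * ε ^ (-p)))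
    (hcost : ∀ d : ℕ+, ∀ σ : ℝ≥0, 0 < σ → σ < 1 →
      cost σ d ≤ 1 + ENNReal.ofReal (D * (d : ℝ) ^ t * (σ : ℝ) ^ (-s))) :
    ∃ A p' : ℝ, 0 ≤ A ∧ 0 ≤ p' ∧ ∀ d : ℕ+, ∀ ε : ℝ, 0 < ε → ε < 1 →
      complexity S cost ε d ≤
        ENNReal.ofReal (A * (d : ℝ) ^ (t + q * (s / 2 + 1)) * ε ^ (-p')) := by
  have hp : 2 ≤ max p 2 := le_max_right _ _
  -- Raising `p` to at least 2 always lands in the first regime, because s < 2(s/2 + 1); no case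
  -- split is needed when only some polynomial rate is wanted.
  obtain ⟨A, hA, h⟩ := dominated_of_lt S hS cost (p := max p 2) (s := s / 2) hC hq (by linarith)
    hD ht (by positivity)
    (fun d ε hε hε1 => (hexact d ε hε hε1).trans (ENNReal.ofReal_le_ofReal
      (mul_le_mul_of_nonneg_left (Real.rpow_le_rpow_of_exponent_ge hε hε1.le
        (neg_le_neg (le_max_left _ _))) (by positivity))))
    (by simpa only [mul_div_cancel₀ s (two_ne_zero : (2 : ℝ) ≠ 0)] using hcost) (by nlinarith)
  exact ⟨A, max p 2 * (s / 2 + 1), hA, by positivity, fun d ε hε hε1 => by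
    simpa only [mul_assoc] using h d ε hε hε1⟩

end Tractability

end NoisyInfo

theorem theorem3p2 {F G : ℕ+ → Type*}
    [∀ d, NormedAddCommGroup (F d)] [∀ d, InnerProductSpace ℝ (F d)]
    [∀ d, CompleteSpace (F d)] [∀ d, TopologicalSpace.SeparableSpace (F d)]
    [∀ d, NormedAddCommGroup (G d)] [∀ d, InnerProductSpace ℝ (G d)]
    [∀ d, CompleteSpace (G d)] [∀ d, TopologicalSpace.SeparableSpace (G d)]
    (S : ∀ d, F d →L[ℝ] G d) (hS0 : ∀ d, S d ≠ 0) (hS : ∀ d, IsCompactOperator (S d))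
    (cost : CostFunction) :
    (PolynomiallyTractable (complexity S cost) ↔
      PolynomiallyTractable (exactComplexity S) ∧ cost.PolynomialGrowth) ∧
    (StronglyPolynomiallyTractable (complexity S cost) ↔
      StronglyPolynomiallyTractable (exactComplexity S) ∧
        cost.PolynomialGrowthUniformInDim ∧ cost.BoundedInDim) ∧
    (∀ C q p D t s : ℝ, 0 ≤ C → 0 ≤ q → 0 ≤ p → 0 ≤ D → 0 ≤ t → 0 ≤ s →
      (∀ d : ℕ+, ∀ ε : ℝ, 0 < ε → ε < 1 →
        exactComplexity S ε d ≤ ENNReal.ofReal (C * (d : ℝ) ^ q * ε ^ (-p))) →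
      (∀ d : ℕ+, ∀ σ : ℝ≥0, 0 < σ → σ < 1 →
        cost σ d ≤ 1 + ENNReal.ofReal (D * (d : ℝ) ^ t * (σ : ℝ) ^ (-(2 * s)))) →
      (p = 0 ∧ s = 0 →
        Dominated (complexity S cost) fun _ d => (d : ℝ) ^ (t + q)) ∧
      (¬(p = 0 ∧ s = 0) →
        (2 * s < p * (s + 1) →
          Dominated (complexity S cost) fun ε d =>
            (d : ℝ) ^ (t + q * (s + 1)) * ε ^ (-(p * (s + 1)))) ∧
        (p * (s + 1) = 2 * s →
          Dominated (complexity S cost) fun ε d =>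
            (d : ℝ) ^ (t + q * (s + 1)) *
              ((1 + Real.log (1 / ε)) ^ (s + 1) * ε ^ (-(2 * s)))) ∧
        (p * (s + 1) < 2 * s →
          Dominated (complexity S cost) fun ε d =>
            (d : ℝ) ^ (t + q * (s + 1)) * ε ^ (-(2 * s))))) := by
  refine ⟨⟨?_, ?_⟩, ⟨?_, ?_⟩, ?_⟩
  · rintro ⟨C, q, p, hC, hq, hp, h⟩
    refine ⟨⟨C, q, p, hC, hq, hp, fun d ε hε hε1 =>
      (exactComplexity_le_complexity S cost ε d).trans (h d ε hε hε1)⟩,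
      C, q, p, hC, hq, hp, fun d σ hσ hσ1 => ?_⟩
    exact (cost_le_complexity S cost (hS0 d) hσ1).trans
      ((h d σ (by exact_mod_cast hσ) (by exact_mod_cast hσ1)).trans le_add_self)
  · rintro ⟨⟨C, q, p, hC, hq, hp, h⟩, D, t, s, hD, ht, hs, hcost⟩
    obtain ⟨A, p', hA, hp', hle⟩ := exists_complexity_le S hS0 cost hC hq hD ht hs h hcost
    exact ⟨A, _, p', hA, by positivity, hp', hle⟩
  · rintro ⟨C, p, hC, hp, h⟩
    have hcost : ∀ d : ℕ+, ∀ σ : ℝ≥0, 0 < σ → σ < 1 →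
        cost σ d ≤ ENNReal.ofReal (C * (σ : ℝ) ^ (-p)) := fun d σ hσ hσ1 =>
      (cost_le_complexity S cost (hS0 d) hσ1).trans
        (h d σ (by exact_mod_cast hσ) (by exact_mod_cast hσ1))
    refine ⟨⟨C, p, hC, hp, fun d ε hε hε1 =>
      (exactComplexity_le_complexity S cost ε d).trans (h d ε hε hε1)⟩,
      ⟨C, p, hC, hp, fun d σ hσ hσ1 => (hcost d σ hσ hσ1).trans le_add_self⟩, fun σ hσ => ?_⟩
    have hhalf : (2⁻¹ : ℝ≥0) < 1 := inv_lt_one_of_one_lt₀ one_lt_two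
    -- The growth bound covers only precisions below one; monotonicity reduces any σ to `min σ 2⁻¹`.
    exact ⟨_, fun d => (cost.antitone_precision d (min_le_left σ 2⁻¹)).trans
      (hcost d _ (lt_min hσ (by positivity)) ((min_le_right _ _).trans_lt hhalf))⟩
  · rintro ⟨⟨C, p, hC, hp, h⟩, ⟨D, s, hD, hs, hcost⟩, -⟩
    -- With q = t = 0 the resulting exponent of `d` vanishes as well, which is what strong
    -- tractability asks for.
    obtain ⟨A, p', hA, hp', hle⟩ := exists_complexity_le S hS0 cost (q := 0) (t := 0) hC le_rfl hD
      le_rfl hs (by simpa using h) (by simpa using hcost)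
    exact ⟨A, p', hA, hp', by simpa using hle⟩
  · intro C q p D t s hC hq hp hD ht hs hexact hcost
    refine ⟨?_, fun _ => ⟨dominated_of_lt S hS0 cost hC hq hp hD ht hs hexact hcost,
      dominated_of_eq S hS0 cost hC hq hp hD ht hs hexact hcost,
      dominated_of_gt S hS0 cost hC hq hp hD ht hs hexact hcost⟩⟩
    rintro ⟨rfl, rfl⟩
    exact dominated_of_zero S hS0 cost hC hq hD ht hexact hcost
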